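/- Let $f_m:=\prod_{j=1}^{\infty}(1-q^{mj})$ for a positive integer $m$, and define the integer sequences $M(n)$ and $T^\ast(n)$, $n\ge 0$, by $$\sum_{n=0}^\infty M(n)q^n=\frac{f_2^5f_5^5}{f_1f_{10}},\qquad \sum_{n=0}^\infty T^\ast(n)q^n=\frac{f_1^5f_{10}^5}{f_2f_5}.$$ Then for all integers $k\ge1$ and $n\ge-1$, $$M(2^kn+2^{k+1}-1)\equiv0\pmod{2^{k-1}}\quad\text{and}\quad T^\ast(2^kn+2^{k+1}-2)\equiv0\pmod{2^{k-1}}.$$ -/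

import Mathlib

namespace PushpaVasuki

open PowerSeries

section EulerProduct

open scoped PowerSeries.WithPiTopology

/-- The Euler product `f_m = ∏_{j ≥ 1} (1 - q^{m j})`, as a formal power series in `q` with
integer coefficients. The infinite product is taken in the topology of coefficientwise
convergence (with `ℤ` discrete). -/
noncomputable def f (m : ℕ) : ℤ⟦X⟧ :=
  ∏' j : ℕ, (1 - (X : ℤ⟦X⟧) ^ (m * (j + 1)))

/-- For `m ≥ 1` the infinite product defining `f m` converges. -/
theorem multipliable_f {m : ℕ} (hm : 1 ≤ m) :
    Multipliable fun j : ℕ => (1 - (X : ℤ⟦X⟧) ^ (m * (j + 1))) := by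
  simp_rw [sub_eq_add_neg]
  apply PowerSeries.WithPiTopology.multipliable_one_add_of_tendsto_order_atTop_nhds_top
  refine ENat.tendsto_nhds_top_iff_natCast_lt.mpr fun n => Filter.eventually_atTop.mpr ⟨n, ?_⟩
  intro j hj
  rw [PowerSeries.order_neg, PowerSeries.order_X_pow]
  exact_mod_cast (by nlinarith : n < m * (j + 1))

theorem constantCoeff_f {m : ℕ} (hm : 1 ≤ m) : constantCoeff (f m) = 1 := by
  unfold f
  rw [(multipliable_f hm).map_tprod (constantCoeff (R := ℤ))
    (PowerSeries.WithPiTopology.continuous_constantCoeff ℤ)]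
  have h : ∀ j : ℕ, constantCoeff (1 - (X : ℤ⟦X⟧) ^ (m * (j + 1))) = 1 := by
    intro j
    have : m * (j + 1) ≠ 0 := by positivity
    simp [this]
  simp [h]

end EulerProduct

/-- `M(n)` is the coefficient of `q^n` in `f_2^5 f_5^5 / (f_1 f_10)`. The denominator has constant
coefficient `1`, and `invOfUnit _ 1` is its inverse power series. -/
noncomputable def M (n : ℕ) : ℤ :=
  coeff n (f 2 ^ 5 * f 5 ^ 5 * invOfUnit (f 1 * f 10) 1)

/-- `T*(n)` is the coefficient of `q^n` in `f_1^5 f_10^5 / (f_2 f_5)`. The denominator has constant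
coefficient `1`, and `invOfUnit _ 1` is its inverse power series. -/
noncomputable def Tstar (n : ℕ) : ℤ :=
  coeff n (f 1 ^ 5 * f 10 ^ 5 * invOfUnit (f 2 * f 5) 1)

/-- The generating function of `M`, with the denominator cleared. -/
theorem mk_M_mul : PowerSeries.mk M * (f 1 * f 10) = f 2 ^ 5 * f 5 ^ 5 := by
  have h : PowerSeries.mk M = f 2 ^ 5 * f 5 ^ 5 * invOfUnit (f 1 * f 10) 1 := by
    ext n; simp [M]
  rw [h, mul_assoc, mul_comm (invOfUnit _ _), mul_invOfUnit, mul_one]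
  simp [constantCoeff_f]

/-- The generating function of `T*`, with the denominator cleared. -/
theorem mk_Tstar_mul : PowerSeries.mk Tstar * (f 2 * f 5) = f 1 ^ 5 * f 10 ^ 5 := by
  have h : PowerSeries.mk Tstar = f 1 ^ 5 * f 10 ^ 5 * invOfUnit (f 2 * f 5) 1 := by
    ext n; simp [Tstar]
  rw [h, mul_assoc, mul_comm (invOfUnit _ _), mul_invOfUnit, mul_one]
  simp [constantCoeff_f]

/-- For `k ≥ 1` and `n ≥ -1` the arguments `2^k n + 2^(k+1) - 1` and `2^k n + 2^(k+1) - 2` are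
nonnegative, so that passing to natural numbers with `Int.toNat` does not change them. -/
theorem argument_nonneg {k : ℕ} {n : ℤ} (hk : 1 ≤ k) (hn : -1 ≤ n) :
    0 ≤ (2 : ℤ) ^ k * n + 2 ^ (k + 1) - 1 ∧ 0 ≤ (2 : ℤ) ^ k * n + 2 ^ (k + 1) - 2 := by
  have h : (2 : ℤ) ^ 1 ≤ 2 ^ k := pow_le_pow_right₀ (by norm_num) hk
  constructor <;> rw [pow_succ] <;> nlinarith

end PushpaVasuki

/-!
Write `F(q) = q ∑ M(n) q^n` and `G(q) = q^2 ∑ T*(n) q^n`; both have weight 4 and level 10. The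
arguments in the theorem are such that the claim reads: for `m ≥ 1` the coefficients of `q^{2^k m}`
in `F` and `G` are divisible by `2^{k-1}`. Let `U` be the operator that keeps the coefficients of
even index, let `φ` and `ψ` be Ramanujan's theta functions, and put

* `H = q f_1^4 f_5^4`,
* `K = q f_1^3 f_2^3 f_5 f_10`,
* `L = q f_1^2 f_5^2 ψ(q)^4`,
* `N = q f_2^2 f_10^2 φ(-q)^4`.

Then `U F = 2 K - H` (`coeff_two_mul_M`), `4 G = H - N` (`four_mul_coeff_Tstar`), and
`U H = -4 H - 8 H(q^2)`, `U K = -2 K - N`, `U L = 2 K`, `U N = -8 L`. Iterating these relations gives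
the powers of two by induction.

Each relation is a 2-dissection. Apart from product formulas for `φ` and `ψ` and the splitting
`φ(q) = φ(q^4) + 2 q ψ(q^8)`, it needs three identities between theta functions
of `q` and `q^5`:

* `φ(q^5) ψ(q^2) - q φ(q) ψ(q^10) = f_1 f_5` (`phi_mul_psi_sub_phi_mul_psi`),
* `ψ(q)^2 - q ψ(q^5)^2 = f_2 f_5^3 / (f_1 f_10)` (`psi_sq_eq_add_theta_mul_theta`),
* `φ(-q^5)^2 - φ(-q)^2 = 4 q f_1 f_10^3 / (f_2 f_5)` (`phiNeg_sq_eq_sub_theta_mul_theta`).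

They are proved by writing both sides as double series over `ℤ^2`, that is, over norms from `ℤ[i]`
or `ℤ[√-5]`, and splitting `ℤ^2` into residue classes modulo `2 + i`, or modulo a prime above 3.
Products and series are linked by the Jacobi triple product `theta_eq`, the limit of a finite form
of the `q`-binomial theorem.
-/

namespace PushpaVasuki

open PowerSeries Filter
open scoped PowerSeries.WithPiTopology Topology

/-! ### Gaussian binomial coefficients -/

section GaussBinomial

variable {R : Type*} [CommRing R]

/-- The Gaussian binomial coefficient `[n choose k]_q`, defined by the `q`-Pascal rule. -/
def gaussBinom (q : R) : ℕ → ℕ → R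
  | _, 0 => 1
  | 0, _ + 1 => 0
  | n + 1, k + 1 => gaussBinom q n k + q ^ (k + 1) * gaussBinom q n (k + 1)

theorem gaussBinom_zero_right (q : R) (n : ℕ) : gaussBinom q n 0 = 1 := by
  cases n <;> rfl

theorem gaussBinom_eq_zero (q : R) {n k : ℕ} (h : n < k) : gaussBinom q n k = 0 := by
  induction n generalizing k with
  | zero => obtain ⟨k, rfl⟩ := Nat.exists_eq_succ_of_ne_zero h.ne'; rfl
  | succ n ih =>
    obtain ⟨k, rfl⟩ := Nat.exists_eq_succ_of_ne_zero (Nat.ne_zero_of_lt h)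
    rw [Nat.succ_eq_add_one, gaussBinom, ih (by omega), ih (by omega)]
    simp

theorem gaussBinom_self (q : R) (n : ℕ) : gaussBinom q n n = 1 := by
  induction n with
  | zero => rfl
  | succ n ih => rw [gaussBinom, ih, gaussBinom_eq_zero q (Nat.lt_succ_self n)]; simp

/-- The `q`-factorial `(1 - q)(1 - q^2)⋯(1 - q^n)`. -/
def qFactorial (q : R) (n : ℕ) : R := ∏ j ∈ Finset.range n, (1 - q ^ (j + 1))

/-- The factorial formula for Gaussian binomial coefficients, with denominators cleared. -/
theorem gaussBinom_mul_qFactorial (q : R) (a b : ℕ) :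
    gaussBinom q (a + b) a * (qFactorial q a * qFactorial q b) = qFactorial q (a + b) := by
  induction h : a + b generalizing a b with
  | zero =>
    obtain ⟨rfl, rfl⟩ : a = 0 ∧ b = 0 := by omega
    simp [gaussBinom_zero_right, qFactorial]
  | succ n ih =>
    rcases a with _ | a
    · obtain rfl : b = n + 1 := by omega
      simp [gaussBinom_zero_right, qFactorial]
    rcases b with _ | b
    · obtain rfl : a = n := by omega
      rw [gaussBinom_self]; simp [qFactorial]
    have h1 := ih a (b + 1) (by omega)
    have h2 := ih (a + 1) b (by omega)
    obtain rfl : n = a + b + 1 := by omega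
    rw [gaussBinom]
    simp only [qFactorial, Finset.prod_range_succ] at h1 h2 ⊢
    linear_combination (1 - q ^ (a + 1)) * h1 + q ^ (a + 1) * (1 - q ^ (b + 1)) * h2

/-- The `q`-binomial theorem in homogeneous form. -/
theorem prod_add_mul_pow (q : R) (M : ℕ) (y z : R) :
    ∏ j ∈ Finset.range M, (y + z * q ^ j) =
      ∑ k ∈ Finset.range (M + 1),
        q ^ (k.choose 2) * gaussBinom q M k * z ^ k * y ^ (M - k) := by
  induction M generalizing z with
  | zero => simp [gaussBinom_zero_right]
  | succ M ih =>
    have hprod : ∏ j ∈ Finset.range (M + 1), (y + z * q ^ j) =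
        z * ∏ j ∈ Finset.range M, (y + z * q * q ^ j) +
          y * ∏ j ∈ Finset.range M, (y + z * q * q ^ j) := by
      rw [Finset.prod_range_succ']
      simp only [pow_succ', pow_zero, ← mul_assoc]
      ring
    have hy : y * ∏ j ∈ Finset.range M, (y + z * q * q ^ j) =
        ∑ k ∈ Finset.range (M + 1),
            q ^ ((k + 1).choose 2 + (k + 1)) * gaussBinom q M (k + 1) * z ^ (k + 1) * y ^ (M - k)
          + y ^ (M + 1) := by
      rw [ih, Finset.sum_range_succ', Finset.sum_range_succ, gaussBinom_eq_zero q M.lt_succ_self,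
        mul_add, Finset.mul_sum]
      congr 1
      · simp only [mul_zero, zero_mul, add_zero]
        refine Finset.sum_congr rfl fun k hk => ?_
        obtain ⟨d, hd⟩ := Nat.exists_eq_add_of_lt (Finset.mem_range.mp hk)
        rw [show M - k = d + 1 by omega, show M - (k + 1) = d by omega]
        ring
      · simp [gaussBinom_zero_right, pow_succ']
    rw [hprod, hy, ih, Finset.sum_range_succ' _ (M + 1), Finset.mul_sum, ← add_assoc,
      ← Finset.sum_add_distrib]
    congr 1
    · refine Finset.sum_congr rfl fun k _ => ?_
      rw [gaussBinom, Nat.succ_sub_succ,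
        show (k + 1).choose 2 = k.choose 2 + k by
          rw [Nat.choose_succ_succ' k 1, Nat.choose_one_right, add_comm]]
      ring
    · simp [gaussBinom_zero_right]

end GaussBinomial

/-! ### Infinite products -/

/-- The infinite product `∏_{j ≥ 0} (1 + ε q^{a + c j})`, for a sign `ε`. -/
noncomputable def signedProd (ε : ℤˣ) (a c : ℕ) : ℤ⟦X⟧ :=
  ∏' j : ℕ, (1 + C (ε : ℤ) * X ^ (a + c * j))

theorem multipliable_signedProd (ε : ℤˣ) (a : ℕ) {c : ℕ} (hc : 1 ≤ c) :
    Multipliable fun j : ℕ => (1 + C (ε : ℤ) * (X : ℤ⟦X⟧) ^ (a + c * j)) := by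
  apply PowerSeries.WithPiTopology.multipliable_one_add_of_tendsto_order_atTop_nhds_top
  refine ENat.tendsto_nhds_top_iff_natCast_lt.mpr fun n =>
    Filter.eventually_atTop.mpr ⟨n + 1, fun j hj => ?_⟩
  refine lt_of_lt_of_le ?_ (le_order_mul _ _)
  rw [order_X_pow]
  refine lt_of_lt_of_le ?_ le_add_self
  exact_mod_cast (by nlinarith : n < a + c * j)

theorem hasProd_signedProd (ε : ℤˣ) (a : ℕ) {c : ℕ} (hc : 1 ≤ c) :
    HasProd (fun j : ℕ => (1 + C (ε : ℤ) * (X : ℤ⟦X⟧) ^ (a + c * j))) (signedProd ε a c) :=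
  (multipliable_signedProd ε a hc).hasProd

theorem f_eq_signedProd (m : ℕ) : f m = signedProd (-1) m m := by
  unfold f signedProd
  refine tprod_congr fun j => ?_
  rw [mul_add, mul_one, add_comm (m * j)]
  simp [sub_eq_add_neg]

/-- Splitting a product according to the residue of the index modulo `k`. -/
theorem signedProd_eq_prod (ε : ℤˣ) (a : ℕ) {c k : ℕ} (hc : 1 ≤ c) (hk : 1 ≤ k) :
    signedProd ε a c = ∏ i : Fin k, signedProd ε (a + c * i) (c * k) := by
  have : NeZero k := ⟨by omega⟩
  have h := (((Nat.divModEquiv k).trans (Equiv.prodComm _ _)).symm.hasProd_iff).mpr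
    (hasProd_signedProd ε a hc)
  refine HasProd.unique (HasProd.prod_fiberwise h fun i => ?_) (hasProd_fintype _)
  convert hasProd_signedProd ε (a + c * i) (Nat.mul_pos hc hk) using 3 with j
  simp only [Nat.divModEquiv, Function.comp_apply, Equiv.symm_trans_apply, Equiv.prodComm_symm,
    Equiv.prodComm_apply, Prod.swap_prod_mk, Equiv.coe_fn_symm_mk]
  ring

theorem signedProd_one_mul_neg_one (a : ℕ) {c : ℕ} (hc : 1 ≤ c) :
    signedProd 1 a c * signedProd (-1) a c = signedProd (-1) (2 * a) (2 * c) := by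
  refine ((hasProd_signedProd 1 a hc).mul (hasProd_signedProd (-1) a hc)).unique ?_
  convert hasProd_signedProd (-1) (2 * a) (show 1 ≤ 2 * c by omega) using 2 with j
  simp
  ring

theorem signedProd_one_zero {c : ℕ} (hc : 1 ≤ c) : signedProd 1 0 c = 2 * signedProd 1 c c := by
  unfold signedProd
  rw [tprod_eq_zero_mul' (by simpa [mul_add, add_comm] using multipliable_signedProd 1 c hc)]
  simp [mul_add, add_comm, one_add_one_eq_two]

theorem tendsto_signedProd (ε : ℤˣ) (a : ℕ) {c : ℕ} (hc : 1 ≤ c) :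
    Tendsto (fun N => ∏ j ∈ Finset.range N, (1 + C (ε : ℤ) * (X : ℤ⟦X⟧) ^ (a + c * j))) atTop
      (𝓝 (signedProd ε a c)) :=
  (hasProd_signedProd ε a hc).tendsto_prod_nat

theorem tendsto_qFactorial {c : ℕ} (hc : 1 ≤ c) :
    Tendsto (qFactorial ((X : ℤ⟦X⟧) ^ c)) atTop (𝓝 (f c)) := by
  convert (multipliable_f hc).hasProd.tendsto_prod_nat using 2 with N
  · simp [qFactorial, pow_mul]
  · rfl

theorem tendsto_iff_eventually_coeff_eq {u : ℕ → ℤ⟦X⟧} {L : ℤ⟦X⟧} :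
    Tendsto u atTop (𝓝 L) ↔ ∀ d, ∀ᶠ N in atTop, coeff d (u N) = coeff d L := by
  simp_rw [WithPiTopology.tendsto_iff_coeff_tendsto, nhds_discrete, tendsto_pure]

theorem X_pow_dvd_f_sub_qFactorial {c d m : ℕ} (hc : 1 ≤ c) (hm : d ≤ m) :
    (X : ℤ⟦X⟧) ^ d ∣ f c - qFactorial (X ^ c) m := by
  rw [X_pow_dvd_iff]
  intro i hi
  obtain ⟨M, hM, hle⟩ := ((tendsto_iff_eventually_coeff_eq.mp (tendsto_qFactorial hc) i).and
    (eventually_ge_atTop m)).exists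
  rw [map_sub, ← hM, ← map_sub]
  refine X_pow_dvd_iff.mp ?_ i hi
  clear hM
  induction M, hle using Nat.le_induction with
  | base => simp
  | succ M hle ih =>
    rw [qFactorial, Finset.prod_range_succ, ← qFactorial]
    have h : (X : ℤ⟦X⟧) ^ d ∣ (X ^ c) ^ (M + 1) := by
      rw [← pow_mul]
      exact pow_dvd_pow _ (by nlinarith)
    convert ih.sub (h.mul_left (qFactorial (X ^ c) M)) using 1
    ring

theorem f_ne_zero {m : ℕ} (hm : 1 ≤ m) : f m ≠ 0 := fun h => by
  simpa [h] using constantCoeff_f hm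

theorem isUnit_f {m : ℕ} (hm : 1 ≤ m) : IsUnit (f m) := by
  rw [PowerSeries.isUnit_iff_constantCoeff, constantCoeff_f hm]
  exact isUnit_one

/-- Modulo a power of `q`, a Gaussian binomial coefficient with both parts large is the inverse of
the infinite Euler product. -/
theorem X_pow_dvd_gaussBinom_mul_f_sub_one {c d a b : ℕ} (hc : 1 ≤ c) (ha : d ≤ a) (hb : d ≤ b) :
    (X : ℤ⟦X⟧) ^ d ∣ gaussBinom (X ^ c) (a + b) a * f c - 1 := by
  rw [← (isUnit_f hc).dvd_mul_right]
  have h := gaussBinom_mul_qFactorial ((X : ℤ⟦X⟧) ^ c) a b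
  have h1 := X_pow_dvd_f_sub_qFactorial hc ha
  have h2 := X_pow_dvd_f_sub_qFactorial hc hb
  have h3 := X_pow_dvd_f_sub_qFactorial hc (show d ≤ a + b by omega)
  have key : (gaussBinom ((X : ℤ⟦X⟧) ^ c) (a + b) a * f c - 1) * f c =
      gaussBinom (X ^ c) (a + b) a * f c * (f c - qFactorial (X ^ c) a) +
      gaussBinom (X ^ c) (a + b) a * qFactorial (X ^ c) a * (f c - qFactorial (X ^ c) b) -
      (f c - qFactorial (X ^ c) (a + b)) := by
    linear_combination h
  rw [key]
  exact ((h1.mul_left _).add (h2.mul_left _)).sub h3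

/-! ### Signed monomials -/

/-- The signed monomial `s q^E`. The exponent is an integer so that it can be computed in a ring;
it is nonnegative wherever this is used. -/
noncomputable def signedMonomial (s : ℤˣ) (E : ℤ) : ℤ⟦X⟧ := C (s : ℤ) * X ^ E.toNat

theorem signedMonomial_mul {s t : ℤˣ} {E F : ℤ} (hE : 0 ≤ E) (hF : 0 ≤ F) :
    signedMonomial s E * signedMonomial t F = signedMonomial (s * t) (E + F) := by
  simp only [signedMonomial, Int.toNat_add hE hF, pow_add, Units.val_mul, map_mul]
  ring

theorem signedMonomial_neg (s : ℤˣ) (E : ℤ) : signedMonomial (-s) E = -signedMonomial s E := by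
  simp [signedMonomial]

/-- A family of signed monomials is summable if only finitely many exponents lie below any given
bound. -/
theorem summable_signedMonomial {ι : Type*} {s : ι → ℤˣ} {E : ι → ℤ}
    (h : ∀ d : ℕ, {i | E i ≤ d}.Finite) : Summable fun i => signedMonomial (s i) (E i) := by
  rw [WithPiTopology.summable_iff_summable_coeff]
  intro d
  refine summable_of_hasFiniteSupport ((h d).subset fun i hi => ?_)
  by_contra hd
  rw [Set.mem_ofPred_eq, not_le] at hd
  refine hi ?_
  change coeff d (signedMonomial (s i) (E i)) = 0
  rw [signedMonomial, coeff_C_mul, coeff_X_pow, if_neg (by omega), mul_zero]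

theorem neg_one_zpow_eq {m n : ℤ} (h : Even (m - n)) : (-1 : ℤˣ) ^ m = (-1) ^ n := by
  rw [← sub_add_cancel m n, zpow_add, h.neg_one_zpow, one_mul]

theorem neg_one_zpow_eq_neg {m n : ℤ} (h : Odd (m - n)) : (-1 : ℤˣ) ^ m = -(-1) ^ n := by
  rw [← sub_add_cancel m n, zpow_add, h.neg_one_zpow, neg_one_mul]

/-! ### Theta series -/

/-- The triangular number `n (n + 1) / 2` of an integer. -/
def tri (n : ℤ) : ℤ := n * (n + 1) / 2

theorem two_mul_tri (n : ℤ) : 2 * tri n = n * (n + 1) :=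
  Int.two_mul_ediv_two_of_even (Int.even_mul_succ_self n)

theorem tri_nonneg (n : ℤ) : 0 ≤ tri n := by
  have h := two_mul_tri n
  rcases le_or_gt 0 n with hn | hn <;> nlinarith

/-- The exponent `a n (n + 1) / 2 + b n (n - 1) / 2` in Ramanujan's theta series `f(q^a, q^b)`. -/
def thetaExp (a b : ℕ) (n : ℤ) : ℤ := a * tri n + b * tri (n - 1)

theorem two_mul_thetaExp (a b : ℕ) (n : ℤ) :
    2 * thetaExp a b n = a * (n * (n + 1)) + b * (n * (n - 1)) := by
  have h1 := two_mul_tri n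
  have h2 := two_mul_tri (n - 1)
  unfold thetaExp
  linear_combination (a : ℤ) * h1 + (b : ℤ) * h2

theorem thetaExp_nonneg (a b : ℕ) (n : ℤ) : 0 ≤ thetaExp a b n :=
  add_nonneg (mul_nonneg (by positivity) (tri_nonneg _)) (mul_nonneg (by positivity) (tri_nonneg _))

theorem abs_le_thetaExp_add_one {a b : ℕ} (hab : 1 ≤ a + b) (n : ℤ) :
    |n| ≤ thetaExp a b n + 1 := by
  have h1 : |n| ≤ tri n + 1 := by
    have h := two_mul_tri n
    rw [abs_le]
    constructor <;> rcases le_or_gt 0 n with hn | hn <;> nlinarith [sq_nonneg (n + 1)]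
  have h2 : |n| ≤ tri (n - 1) + 1 := by
    have h := two_mul_tri (n - 1)
    rw [abs_le]
    constructor <;> rcases le_or_gt 0 n with hn | hn <;>
      nlinarith [sq_nonneg (n + 1), sq_nonneg (n - 1)]
  have h3 := tri_nonneg n
  have h4 := tri_nonneg (n - 1)
  unfold thetaExp
  rcases Nat.eq_zero_or_pos a with rfl | ha
  · have : (1 : ℤ) ≤ b := by exact_mod_cast (by omega : 1 ≤ b)
    push_cast
    nlinarith
  · have : (1 : ℤ) ≤ a := by exact_mod_cast ha
    have : (0 : ℤ) ≤ b := by positivity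
    nlinarith

theorem finite_thetaExp_le {a b : ℕ} (hab : 1 ≤ a + b) (d : ℕ) :
    {n : ℤ | thetaExp a b n ≤ d}.Finite := by
  refine (Set.finite_Icc (-(d + 1 : ℤ)) (d + 1)).subset fun n hn => ?_
  have h := abs_le_thetaExp_add_one hab n
  rw [Set.mem_ofPred_eq] at hn
  exact abs_le.mp (by linarith)

/-- Ramanujan's theta series `f(ε q^a, ε q^b) = ∑_n ε^n q^{a n (n + 1) / 2 + b n (n - 1) / 2}`, for
a sign `ε`. -/
noncomputable def theta (ε : ℤˣ) (a b : ℕ) : ℤ⟦X⟧ :=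
  ∑' n : ℤ, signedMonomial (ε ^ n) (thetaExp a b n)

theorem hasSum_theta (ε : ℤˣ) {a b : ℕ} (hab : 1 ≤ a + b) :
    HasSum (fun n : ℤ => signedMonomial (ε ^ n) (thetaExp a b n)) (theta ε a b) :=
  (summable_signedMonomial (finite_thetaExp_le hab)).hasSum

theorem summable_theta_mul_theta (ε δ : ℤˣ) {a b c d : ℕ} (hab : 1 ≤ a + b) (hcd : 1 ≤ c + d) :
    Summable fun p : ℤ × ℤ => signedMonomial (ε ^ p.1 * δ ^ p.2)
      (thetaExp a b p.1 + thetaExp c d p.2) := by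
  refine summable_signedMonomial (s := fun p : ℤ × ℤ => ε ^ p.1 * δ ^ p.2)
    (E := fun p : ℤ × ℤ => thetaExp a b p.1 + thetaExp c d p.2) fun N =>
    ((finite_thetaExp_le hab N).prod (finite_thetaExp_le hcd N)).subset fun p hp => ?_
  have h1 := thetaExp_nonneg a b p.1
  have h2 := thetaExp_nonneg c d p.2
  replace hp : thetaExp a b p.1 + thetaExp c d p.2 ≤ N := hp
  exact ⟨show thetaExp a b p.1 ≤ N by linarith, show thetaExp c d p.2 ≤ N by linarith⟩

/-- The product of two theta series as a double series. -/
theorem hasSum_theta_mul_theta (ε δ : ℤˣ) {a b c d : ℕ} (hab : 1 ≤ a + b) (hcd : 1 ≤ c + d) :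
    HasSum (fun p : ℤ × ℤ => signedMonomial (ε ^ p.1 * δ ^ p.2)
      (thetaExp a b p.1 + thetaExp c d p.2)) (theta ε a b * theta δ c d) := by
  have h : ∀ p : ℤ × ℤ, signedMonomial (ε ^ p.1 * δ ^ p.2)
      (thetaExp a b p.1 + thetaExp c d p.2) = signedMonomial (ε ^ p.1) (thetaExp a b p.1) *
        signedMonomial (δ ^ p.2) (thetaExp c d p.2) := fun p =>
    (signedMonomial_mul (thetaExp_nonneg _ _ _) (thetaExp_nonneg _ _ _)).symm
  have hs := summable_theta_mul_theta ε δ hab hcd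
  rw [funext h] at hs ⊢
  exact HasSum.mul (f := fun n : ℤ => signedMonomial (ε ^ n) (thetaExp a b n))
    (g := fun n : ℤ => signedMonomial (δ ^ n) (thetaExp c d n))
    (hasSum_theta ε hab) (hasSum_theta δ hcd) hs

/-! ### The Jacobi triple product -/

theorem two_mul_choose_two (k : ℕ) : (2 : ℤ) * (k.choose 2 : ℕ) = k * (k - 1) := by
  induction k with
  | zero => simp
  | succ k ih =>
    rw [Nat.choose_succ_succ' k 1, Nat.choose_one_right]
    push_cast
    linear_combination ih

theorem two_mul_sum_range_add_mul (a c N : ℕ) :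
    2 * ∑ j ∈ Finset.range N, ((a : ℤ) + c * j) = 2 * a * N + c * (N * (N - 1)) := by
  induction N with
  | zero => simp
  | succ N ih =>
    rw [Finset.sum_range_succ]
    push_cast
    linear_combination ih

/-- A finite form of the Jacobi triple product, obtained from the `q`-binomial theorem for the
exponent `2 N` by shifting the index of summation by `N`. -/
theorem prod_eq_sum_gaussBinom (ε : ℤˣ) (a b N : ℕ) :
    (∏ j ∈ Finset.range N, (1 + C (ε : ℤ) * (X : ℤ⟦X⟧) ^ (a + (a + b) * j))) *
      ∏ j ∈ Finset.range N, (1 + C (ε : ℤ) * (X : ℤ⟦X⟧) ^ (b + (a + b) * j)) =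
    ∑ n ∈ Finset.Icc (-N : ℤ) N, signedMonomial (ε ^ n) (thetaExp a b n) *
      gaussBinom (X ^ (a + b)) (2 * N) (n + N).toNat := by
  have hεε : (C (ε : ℤ) : ℤ⟦X⟧) * C (ε : ℤ) = 1 := by
    rw [← map_mul, ← Units.val_mul, Int.units_mul_self, Units.val_one, map_one]
  have hbinom := prod_add_mul_pow ((X : ℤ⟦X⟧) ^ (a + b)) (N + N) (X ^ ((a + b) * N))
    (C (ε : ℤ) * X ^ a)
  -- The factor `q^{cN} + ε q^{a + cj}`, with `c = a + b`, is `ε q^{a + cj}` times a factor of the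
  -- second product when `j < N`, and `q^{cN}` times a factor of the first product otherwise.
  have hfactor : ∏ j ∈ Finset.range (N + N),
      ((X : ℤ⟦X⟧) ^ ((a + b) * N) + C (ε : ℤ) * X ^ a * (X ^ (a + b)) ^ j) =
      (C (ε : ℤ) ^ N * X ^ (∑ j ∈ Finset.range N, (a + (a + b) * j) + (a + b) * N * N)) *
      ((∏ j ∈ Finset.range N, (1 + C (ε : ℤ) * (X : ℤ⟦X⟧) ^ (a + (a + b) * j))) *
      ∏ j ∈ Finset.range N, (1 + C (ε : ℤ) * (X : ℤ⟦X⟧) ^ (b + (a + b) * j))) := by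
    rw [Finset.prod_range_add]
    have h1 : ∏ j ∈ Finset.range N,
        ((X : ℤ⟦X⟧) ^ ((a + b) * N) + C (ε : ℤ) * X ^ a * (X ^ (a + b)) ^ j) =
        (C (ε : ℤ) ^ N * X ^ (∑ j ∈ Finset.range N, (a + (a + b) * j))) *
        ∏ j ∈ Finset.range N, (1 + C (ε : ℤ) * (X : ℤ⟦X⟧) ^ (b + (a + b) * j)) := by
      rw [← Finset.prod_range_reflect (fun j => 1 + C (ε : ℤ) * (X : ℤ⟦X⟧) ^ (b + (a + b) * j)),
        ← Finset.prod_pow_eq_pow_sum]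
      conv_rhs => enter [1, 1, 2]; rw [← Finset.card_range N]
      rw [← Finset.prod_const, ← Finset.prod_mul_distrib, ← Finset.prod_mul_distrib]
      refine Finset.prod_congr rfl fun j hj => ?_
      obtain ⟨i, rfl⟩ := Nat.exists_eq_add_of_lt (Finset.mem_range.mp hj)
      rw [show j + i + 1 - 1 - j = i by omega]
      linear_combination (-(X : ℤ⟦X⟧) ^ ((a + b) * (j + i + 1))) * hεε
    have h2 : ∏ j ∈ Finset.range N,
        ((X : ℤ⟦X⟧) ^ ((a + b) * N) + C (ε : ℤ) * X ^ a * (X ^ (a + b)) ^ (N + j)) =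
        X ^ ((a + b) * N * N) *
        ∏ j ∈ Finset.range N, (1 + C (ε : ℤ) * (X : ℤ⟦X⟧) ^ (a + (a + b) * j)) := by
      rw [pow_mul _ ((a + b) * N)]
      conv_rhs => enter [1, 2]; rw [← Finset.card_range N]
      rw [← Finset.prod_const, ← Finset.prod_mul_distrib]
      refine Finset.prod_congr rfl fun j _ => ?_
      ring
    rw [h1, h2]
    ring
  have hC : (C (ε : ℤ) : ℤ⟦X⟧) ≠ 0 := fun h => by simp [h] at hεε
  have hne : (C (ε : ℤ) ^ N *
      X ^ (∑ j ∈ Finset.range N, (a + (a + b) * j) + (a + b) * N * N) : ℤ⟦X⟧) ≠ 0 :=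
    mul_ne_zero (pow_ne_zero _ hC) (pow_ne_zero _ X_ne_zero)
  refine mul_left_cancel₀ hne ?_
  rw [← hfactor, hbinom, Finset.mul_sum]
  refine Finset.sum_bij' (fun k _ => (k : ℤ) - N) (fun n _ => (n + N).toNat) ?_ ?_ ?_ ?_ ?_
  · intro k hk
    rw [Finset.mem_range] at hk
    rw [Finset.mem_Icc]
    omega
  · intro n hn
    rw [Finset.mem_Icc] at hn
    rw [Finset.mem_range]
    omega
  · intro k _
    simp
  · intro n hn
    rw [Finset.mem_Icc] at hn
    omega
  · intro k hk
    rw [Finset.mem_range] at hk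
    obtain ⟨l, hl⟩ := Nat.exists_eq_add_of_le (Nat.le_of_lt_succ hk)
    have hsign : (C (ε : ℤ) : ℤ⟦X⟧) ^ k = C (ε : ℤ) ^ N * C ((ε ^ ((k : ℤ) - N) : ℤˣ) : ℤ) := by
      rw [← map_pow, ← map_pow, ← map_mul, ← Units.val_pow_eq_pow_val, ← Units.val_pow_eq_pow_val,
        ← Units.val_mul, ← zpow_natCast, ← zpow_natCast, ← zpow_add]
      simp
    have hexp : (a + b) * k.choose 2 + a * k + (a + b) * N * l =
        ∑ j ∈ Finset.range N, (a + (a + b) * j) + (a + b) * N * N +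
          (thetaExp a b ((k : ℤ) - N)).toNat := by
      have h1 := two_mul_thetaExp a b ((k : ℤ) - N)
      have h2 := two_mul_choose_two k
      have h3 := two_mul_sum_range_add_mul a (a + b) N
      have hl' : (N : ℤ) + N = k + l := by exact_mod_cast hl
      have hl'' : (l : ℤ) = N + N - k := by linarith
      zify
      rw [Int.toNat_of_nonneg (thetaExp_nonneg _ _ _), hl'']
      push_cast at h3 ⊢
      have key : (2 : ℤ) * ((a + b) * k.choose 2 + a * k + (a + b) * N * (N + N - k)) =
        2 * (∑ j ∈ Finset.range N, ((a : ℤ) + (a + b) * j) + (a + b) * N * N +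
          thetaExp a b ((k : ℤ) - N)) := by
        linear_combination ((a : ℤ) + b) * h2 - h3 - h1
      linarith
    rw [show N + N - k = l by omega, sub_add_cancel, Int.toNat_natCast, signedMonomial, ← two_mul,
      mul_pow, hsign]
    calc _ = C (ε : ℤ) ^ N * C ((ε ^ ((k : ℤ) - N) : ℤˣ) : ℤ) *
          X ^ ((a + b) * k.choose 2 + a * k + (a + b) * N * l) *
          gaussBinom (X ^ (a + b)) (2 * N) k := by ring
      _ = _ := by rw [hexp]; ring

/-- **Jacobi triple product identity**, for series in one variable. -/
theorem theta_eq (ε : ℤˣ) {a b : ℕ} (hab : 1 ≤ a + b) :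
    theta ε a b = signedProd ε a (a + b) * signedProd ε b (a + b) * f (a + b) := by
  have hsum : Tendsto (fun N : ℕ => ∑ n ∈ Finset.Icc (-N : ℤ) N,
      signedMonomial (ε ^ n) (thetaExp a b n)) atTop (𝓝 (theta ε a b)) :=
    (hasSum_theta ε hab).comp Finset.tendsto_Icc_neg
  have hprod := (((tendsto_signedProd ε a hab).mul (tendsto_signedProd ε b hab)).mul_const
    (f (a + b)))
  refine tendsto_nhds_unique hsum ?_
  rw [tendsto_iff_eventually_coeff_eq] at hprod ⊢
  intro d
  filter_upwards [hprod d, eventually_ge_atTop (2 * d + 4)] with N hN hle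
  rw [← hN, prod_eq_sum_gaussBinom, ← sub_eq_zero, ← map_sub, Finset.sum_mul,
    ← Finset.sum_sub_distrib]
  refine X_pow_dvd_iff.mp (Finset.dvd_sum fun n hn => ?_) d (Nat.lt_succ_self d)
  rw [Finset.mem_Icc] at hn
  -- Either `|n|` is small and the Gaussian binomial coefficient is close to its limit, or the
  -- exponent of `q` is large.
  by_cases hsmall : |n| ≤ N - (d + 1)
  · rw [abs_le] at hsmall
    have h := X_pow_dvd_gaussBinom_mul_f_sub_one (d := d + 1) (a := (n + N).toNat)
      (b := (N - n).toNat) hab (by omega) (by omega)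
    rw [show (n + N).toNat + (N - n).toNat = 2 * N by omega] at h
    convert (h.mul_left (signedMonomial (ε ^ n) (thetaExp a b n))).neg_right using 1
    ring
  · have h := abs_le_thetaExp_add_one hab n
    have hX : (X : ℤ⟦X⟧) ^ (d + 1) ∣ signedMonomial (ε ^ n) (thetaExp a b n) :=
      (pow_dvd_pow X (by omega)).mul_left _
    exact hX.sub ((hX.mul_right _).mul_right _)

/-! ### Product formulas for theta functions -/

theorem f_eq_signedProd_mul_f {m : ℕ} (hm : 1 ≤ m) :
    f m = signedProd (-1) m (2 * m) * f (2 * m) := by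
  rw [f_eq_signedProd m, signedProd_eq_prod _ _ hm one_le_two, Fin.prod_univ_two, mul_comm m 2,
    f_eq_signedProd (2 * m)]
  simp [two_mul]

theorem signedProd_one_mul_f {m : ℕ} (hm : 1 ≤ m) : signedProd 1 m m * f m = f (2 * m) := by
  rw [f_eq_signedProd, f_eq_signedProd, signedProd_one_mul_neg_one m hm]

/-- Euler's pentagonal number theorem. -/
theorem f_eq_theta {m : ℕ} (hm : 1 ≤ m) : f m = theta (-1) m (2 * m) := by
  rw [theta_eq _ (by omega), f_eq_signedProd, f_eq_signedProd,
    signedProd_eq_prod _ _ hm (show 1 ≤ 3 by norm_num), Fin.prod_univ_three]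
  simp [show m * 3 = m + 2 * m by ring, show m + m = 2 * m by ring, show m * 2 = 2 * m by ring]

/-- Ramanujan's theta function `φ(q^m) = ∑_n q^{m n^2}`. -/
noncomputable def phi (m : ℕ) : ℤ⟦X⟧ := theta 1 m m

/-- The alternating theta function `∑_n (-1)^n q^{m n^2}`, which is `φ(-q^m)` when the sign is read
as attached to `q^m`. -/
noncomputable def phiNeg (m : ℕ) : ℤ⟦X⟧ := theta (-1) m m

/-- Ramanujan's theta function `ψ(q^m) = ∑_{n ≥ 0} q^{m n (n + 1) / 2}`, encoded as the quotient
`f_{2m}^2 / f_m`. -/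
noncomputable def psi (m : ℕ) : ℤ⟦X⟧ := f (2 * m) ^ 2 * invOfUnit (f m) 1

theorem psi_mul_f {m : ℕ} (hm : 1 ≤ m) : psi m * f m = f (2 * m) ^ 2 := by
  rw [psi, mul_assoc, mul_comm (invOfUnit _ _), mul_invOfUnit _ _ (by simp [constantCoeff_f hm]),
    mul_one]

theorem phiNeg_mul_f {m : ℕ} (hm : 1 ≤ m) : phiNeg m * f (2 * m) = f m ^ 2 := by
  rw [phiNeg, theta_eq _ (by omega), f_eq_signedProd_mul_f hm, two_mul]
  ring

/-- Gauss's identity: the series of `ψ`, summed over all integers, counts every exponent twice. -/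
theorem two_mul_psi {m : ℕ} (hm : 1 ≤ m) : 2 * psi m = theta 1 m 0 := by
  refine mul_right_cancel₀ (f_ne_zero hm) ?_
  rw [theta_eq _ (by omega), add_zero, signedProd_one_zero hm]
  linear_combination 2 * psi_mul_f hm - 2 * (f (2 * m) + signedProd 1 m m * f m) *
    signedProd_one_mul_f hm

/-- `φ(q) φ(-q) = φ(-q^2)^2`, for `q^m` in place of `q`. -/
theorem phi_mul_phiNeg {m : ℕ} (hm : 1 ≤ m) : phi m * phiNeg m = phiNeg (2 * m) ^ 2 := by
  have h1 := signedProd_one_mul_neg_one m (show 1 ≤ 2 * m by omega)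
  have h2 := f_eq_signedProd_mul_f (show 1 ≤ 2 * m by omega)
  rw [phi, phiNeg, phiNeg, theta_eq _ (by omega), theta_eq _ (by omega), theta_eq _ (by omega),
    ← two_mul, ← two_mul, h2, ← h1]
  ring

/-- `φ(q) ψ(q^2) = ψ(q)^2`, for `q^m` in place of `q`. -/
theorem phi_mul_psi {m : ℕ} (hm : 1 ≤ m) : phi m * psi (2 * m) = psi m ^ 2 := by
  have h1 := signedProd_one_mul_neg_one m (show 1 ≤ 2 * m by omega)
  have h2 := f_eq_signedProd_mul_f (show 1 ≤ 2 * m by omega)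
  have h3 := f_eq_signedProd_mul_f hm
  have h4 := psi_mul_f hm
  have h5 := psi_mul_f (show 1 ≤ 2 * m by omega)
  have hm2 := f_ne_zero (show 1 ≤ 2 * m by omega)
  have hne : f m ^ 2 * f (2 * m) ≠ 0 := mul_ne_zero (pow_ne_zero _ (f_ne_zero hm)) hm2
  refine mul_right_cancel₀ hne ?_
  have h6 : signedProd 1 m (2 * m) * f m * f (2 * (2 * m)) = f (2 * m) ^ 2 := by
    rw [h3, mul_comm _ (f (2 * m)), mul_left_comm, h1]
    linear_combination -f (2 * m) * h2
  rw [phi, theta_eq _ (by omega), ← two_mul]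
  calc _ = (signedProd 1 m (2 * m) * f m) ^ 2 * f (2 * m) * (psi (2 * m) * f (2 * m)) := by ring
    _ = (signedProd 1 m (2 * m) * f m * f (2 * (2 * m))) ^ 2 * f (2 * m) := by rw [h5]; ring
    _ = (psi m * f m) ^ 2 * f (2 * m) := by rw [h6, h4]
    _ = _ := by ring

theorem phiNeg_mul_psi {m : ℕ} (hm : 1 ≤ m) : phiNeg m * psi m = f m * f (2 * m) := by
  refine mul_right_cancel₀ (mul_ne_zero (f_ne_zero hm) (f_ne_zero (show 1 ≤ 2 * m by omega))) ?_
  linear_combination psi m * f m * phiNeg_mul_f hm + f m ^ 2 * psi_mul_f hm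

/-- The two products run over the residues prime to 5; the missing residue is supplied by
`f_10 / f_5`. -/
theorem theta_one_four_mul_theta_two_three :
    theta 1 1 4 * theta 1 2 3 * (f 1 * f 10) = f 2 * f 5 ^ 3 := by
  have h := signedProd_eq_prod 1 1 le_rfl (show 1 ≤ 5 by norm_num)
  simp [Fin.prod_univ_five] at h
  have h1 := signedProd_one_mul_f (show 1 ≤ 1 by norm_num)
  have h5 := signedProd_one_mul_f (show 1 ≤ 5 by norm_num)
  norm_num at h1 h5
  rw [theta_eq _ (by norm_num), theta_eq _ (by norm_num), ← h1, ← h5, h]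
  norm_num
  ring

/-- The two products run over the odd residues modulo 10 other than 5; the missing residue is
supplied by `f_5 / f_10`. -/
theorem theta_one_nine_mul_theta_three_seven :
    theta (-1) 1 9 * theta (-1) 3 7 * (f 2 * f 5) = f 1 * f 10 ^ 3 := by
  have h := signedProd_eq_prod (-1) 1 (show 1 ≤ 2 by norm_num) (show 1 ≤ 5 by norm_num)
  simp [Fin.prod_univ_five] at h
  have h1 := f_eq_signedProd_mul_f (show 1 ≤ 1 by norm_num)
  have h5 := f_eq_signedProd_mul_f (show 1 ≤ 5 by norm_num)
  norm_num at h1 h5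
  rw [theta_eq _ (by norm_num), theta_eq _ (by norm_num), h1, h5, h]
  norm_num
  ring

/-! ### The substitution `q ↦ q^2` -/

/-- The substitution `q ↦ q^2`. -/
noncomputable def dilate : ℤ⟦X⟧ →ₐ[ℤ] ℤ⟦X⟧ := expand 2 two_ne_zero

theorem coeff_dilate_two_mul (A : ℤ⟦X⟧) (n : ℕ) : coeff (2 * n) (dilate A) = coeff n A :=
  coeff_expand_mul _ _ _ _

theorem coeff_dilate_two_mul_add_one (A : ℤ⟦X⟧) (n : ℕ) : coeff (2 * n + 1) (dilate A) = 0 :=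
  coeff_expand_of_not_dvd _ _ _ (by omega)

theorem dilate_X : dilate X = X ^ 2 := expand_X _ _

theorem dilate_injective : Function.Injective dilate := fun A B h => by
  ext n
  rw [← coeff_dilate_two_mul, h, coeff_dilate_two_mul]

theorem continuous_dilate : Continuous dilate := by
  rw [continuous_iff_continuousAt]
  intro A
  rw [ContinuousAt, WithPiTopology.tendsto_iff_coeff_tendsto]
  intro d
  obtain ⟨n, rfl | rfl⟩ := Nat.even_or_odd' d
  · simp_rw [coeff_dilate_two_mul]
    exact (WithPiTopology.continuous_coeff ℤ n).continuousAt
  · simp_rw [coeff_dilate_two_mul_add_one]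
    exact tendsto_const_nhds

theorem dilate_theta (ε : ℤˣ) {a b : ℕ} (hab : 1 ≤ a + b) :
    dilate (theta ε a b) = theta ε (2 * a) (2 * b) := by
  refine ((hasSum_theta ε hab).map dilate continuous_dilate).unique ?_
  convert hasSum_theta ε (show 1 ≤ 2 * a + 2 * b by omega) using 2 with n
  have h : (thetaExp (2 * a) (2 * b) n).toNat = 2 * (thetaExp a b n).toNat := by
    have h1 := two_mul_thetaExp (2 * a) (2 * b) n
    have h2 := two_mul_thetaExp a b n
    have h3 : thetaExp (2 * a) (2 * b) n = 2 * thetaExp a b n := by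
      push_cast at h1
      linarith
    omega
  rw [Function.comp_apply, signedMonomial, signedMonomial, map_mul, map_pow, dilate_X, h, pow_mul,
    dilate, expand_C]

theorem dilate_f {m : ℕ} (hm : 1 ≤ m) : dilate (f m) = f (2 * m) := by
  rw [f_eq_theta hm, f_eq_theta (by omega), dilate_theta _ (by omega)]

theorem dilate_phi {m : ℕ} (hm : 1 ≤ m) : dilate (phi m) = phi (2 * m) :=
  dilate_theta _ (by omega)

theorem dilate_phiNeg {m : ℕ} (hm : 1 ≤ m) : dilate (phiNeg m) = phiNeg (2 * m) :=
  dilate_theta _ (by omega)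

theorem dilate_psi {m : ℕ} (hm : 1 ≤ m) : dilate (psi m) = psi (2 * m) := by
  refine mul_right_cancel₀ (f_ne_zero (show 1 ≤ 2 * m by omega)) ?_
  rw [psi_mul_f (by omega), ← dilate_f hm, ← map_mul, psi_mul_f hm, map_pow,
    dilate_f (show 1 ≤ 2 * m by omega)]

/-! ### Theta identities from partitions of the index set -/

/-- If the ranges of the injective maps `g i` partition the index set of a convergent series, the
sum is the sum of the partial sums along the `g i`. -/
theorem eq_sum_of_hasSum_of_partition {J K : Type*} {r : ℕ} {F : J → ℤ⟦X⟧} {S : ℤ⟦X⟧}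
    (hS : HasSum F S) (g : Fin r → K → J)
    (hinj : Function.Injective fun p : Fin r × K => g p.1 p.2)
    (hsurj : Function.Surjective fun p : Fin r × K => g p.1 p.2)
    {s : Fin r → ℤ⟦X⟧} (h : ∀ i, HasSum (fun k => F (g i k)) (s i)) : S = ∑ i, s i :=
  (HasSum.prod_fiberwise ((Equiv.ofBijective _ ⟨hinj, hsurj⟩).hasSum_iff.mpr hS) h).unique
    (hasSum_fintype s)

theorem hasSum_of_forall_eq {J : Type*} {F G : J → ℤ⟦X⟧} {S : ℤ⟦X⟧} (h : ∀ j, F j = G j)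
    (hG : HasSum G S) : HasSum F S :=
  funext h ▸ hG

theorem charZero_powerSeries : CharZero ℤ⟦X⟧ :=
  charZero_of_injective_ringHom (f := C) C_injective

theorem X_pow_mul_signedMonomial {s : ℤˣ} {E : ℤ} (m : ℕ) (hE : 0 ≤ E) :
    X ^ m * signedMonomial s E = signedMonomial s (E + m) := by
  rw [signedMonomial, signedMonomial, Int.toNat_add hE (Int.natCast_nonneg m), Int.toNat_natCast]
  ring

theorem X_mul_signedMonomial {s : ℤˣ} {E : ℤ} (hE : 0 ≤ E) :
    X * signedMonomial s E = signedMonomial s (E + 1) := by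
  simpa using X_pow_mul_signedMonomial 1 hE

theorem thetaExp_add_eq {a b c d a' b' c' d' : ℕ} {m n m' n' k : ℤ}
    (h : a * (m * (m + 1)) + b * (m * (m - 1)) + (c * (n * (n + 1)) + d * (n * (n - 1))) =
      a' * (m' * (m' + 1)) + b' * (m' * (m' - 1)) +
        (c' * (n' * (n' + 1)) + d' * (n' * (n' - 1))) + 2 * k) :
    thetaExp a b m + thetaExp c d n = thetaExp a' b' m' + thetaExp c' d' n' + k := by
  have h1 := two_mul_thetaExp a b m
  have h2 := two_mul_thetaExp c d n
  have h3 := two_mul_thetaExp a' b' m'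
  have h4 := two_mul_thetaExp c' d' n'
  linarith

theorem hasSum_X_mul_theta_mul_theta (ε δ : ℤˣ) {a b c d : ℕ} (hab : 1 ≤ a + b)
    (hcd : 1 ≤ c + d) :
    HasSum (fun p : ℤ × ℤ => signedMonomial (ε ^ p.1 * δ ^ p.2)
      (thetaExp a b p.1 + thetaExp c d p.2 + 1)) (X * (theta ε a b * theta δ c d)) := by
  have h := (hasSum_theta_mul_theta ε δ hab hcd).mul_left X
  refine hasSum_of_forall_eq (fun p => ?_) h
  exact (X_mul_signedMonomial (add_nonneg (thetaExp_nonneg _ _ _) (thetaExp_nonneg _ _ _))).symm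

/-- `φ(± q^m)` split by the parity of the index of summation. -/
theorem theta_eq_phi_add_psi (ε : ℤˣ) {m : ℕ} (hm : 1 ≤ m) :
    theta ε m m = phi (4 * m) + 2 * C (ε : ℤ) * X ^ m * psi (8 * m) := by
  have h := eq_sum_of_hasSum_of_partition (hasSum_theta ε (show 1 ≤ m + m by omega))
    (r := 2) (fun i (n : ℤ) => match i with | 0 => 2 * n | 1 => 2 * n + 1) ?_ ?_
    (s := fun i => match i with
      | 0 => phi (4 * m)
      | 1 => C (ε : ℤ) * X ^ m * theta 1 (8 * m) 0) ?_
  · rw [h, Fin.sum_univ_two, ← two_mul_psi (by omega)]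
    ring
  · rintro ⟨i, m⟩ ⟨j, n⟩ h
    fin_cases i <;> fin_cases j <;> simp at h ⊢ <;> omega
  · intro n
    obtain ⟨m, rfl | rfl⟩ := Int.even_or_odd' n
    exacts [⟨(0, m), rfl⟩, ⟨(1, m), rfl⟩]
  · intro i
    fin_cases i
    · refine hasSum_of_forall_eq (fun n => ?_) (hasSum_theta 1 (show 1 ≤ 4 * m + 4 * m by omega))
      have h1 := two_mul_thetaExp m m (2 * n)
      have h2 := two_mul_thetaExp (4 * m) (4 * m) n
      push_cast at h1 h2
      congr 1
      · simp [zpow_mul]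
      · linarith
    · refine hasSum_of_forall_eq (fun n => ?_)
        ((hasSum_theta 1 (show 1 ≤ 8 * m + 0 by omega)).mul_left (C (ε : ℤ) * X ^ m))
      have h1 := two_mul_thetaExp m m (2 * n + 1)
      have h2 := two_mul_thetaExp (8 * m) 0 n
      push_cast at h1 h2
      rw [mul_assoc, X_pow_mul_signedMonomial m (thetaExp_nonneg _ _ _),
        show thetaExp (8 * m) 0 n + m = thetaExp m m (2 * n + 1) by linarith]
      simp [signedMonomial, zpow_add, zpow_mul]

/-- `ψ(q)^2` is four times a sum over the Gaussian integers of odd norm. Those divisible by `2 + i`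
give `q ψ(q^5)^2`; multiplication by the units permutes the other four residue classes modulo
`2 + i`, each of which gives a product of two theta series. -/
theorem psi_sq_eq_add_theta_mul_theta :
    psi 1 ^ 2 = X * psi 5 ^ 2 + theta 1 1 4 * theta 1 2 3 := by
  -- The pair `(m, n)` stands for `(2 m + 1) + (2 n + 1) i`. Map 0 is multiplication by `2 + i`, map 1
  -- sends `(a, b)` to `((10 a - 3) + (10 b - 1) i) / (2 - i)`, and maps 2, 3, 4 are its rotations.
  have h := eq_sum_of_hasSum_of_partition
    (hasSum_theta_mul_theta 1 1 (show 1 ≤ 1 + 0 by norm_num) (show 1 ≤ 1 + 0 by norm_num))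
    (r := 5) (fun i (p : ℤ × ℤ) => match i with
      | 0 => (2 * p.1 - p.2, p.1 + 2 * p.2 + 1)
      | 1 => (2 * p.1 - p.2 - 1, p.1 + 2 * p.2 - 1)
      | 2 => (-p.1 - 2 * p.2, 2 * p.1 - p.2 - 1)
      | 3 => (-2 * p.1 + p.2, -p.1 - 2 * p.2)
      | 4 => (p.1 + 2 * p.2 - 1, -2 * p.1 + p.2)) ?_ ?_
    (s := fun i => match i with
      | 0 => X * (theta 1 5 0 * theta 1 5 0)
      | 1 | 2 | 3 | 4 => theta 1 1 4 * theta 1 2 3) ?_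
  · simp only [Fin.sum_univ_five] at h
    rw [← two_mul_psi le_rfl, ← two_mul_psi (show 1 ≤ 5 by norm_num)] at h
    have := charZero_powerSeries
    refine mul_left_cancel₀ (show (4 : ℤ⟦X⟧) ≠ 0 by norm_num) ?_
    linear_combination h
  · rintro ⟨i, a, b⟩ ⟨j, c, d⟩ h
    fin_cases i <;> fin_cases j <;> simp at h ⊢ <;> omega
  · rintro ⟨m, n⟩
    have hcases : (2 * m + n) % 5 = 1 ∨ (2 * m + n) % 5 = 2 ∨ (2 * m + n) % 5 = 4 ∨
      (2 * m + n) % 5 = 0 ∨ (2 * m + n) % 5 = 3 := by omega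
    rcases hcases with hc | hc | hc | hc | hc
    · exact ⟨(0, (2 * m + n - 1) / 5, (2 * n - m - 2) / 5), by ext <;> dsimp only <;> omega⟩
    · exact ⟨(1, (2 * m + n + 3) / 5, (2 * n - m + 1) / 5), by ext <;> dsimp only <;> omega⟩
    · exact ⟨(2, (2 * n - m + 2) / 5, -(2 * m + n + 1) / 5), by ext <;> dsimp only <;> omega⟩
    · exact ⟨(3, -(2 * m + n) / 5, (m - 2 * n) / 5), by ext <;> dsimp only <;> omega⟩
    · exact ⟨(4, (m - 2 * n + 1) / 5, (2 * m + n + 2) / 5), by ext <;> dsimp only <;> omega⟩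
  · intro i
    fin_cases i
    · refine hasSum_of_forall_eq (fun p => ?_) (hasSum_X_mul_theta_mul_theta 1 1
        (show 1 ≤ 5 + 0 by norm_num) (show 1 ≤ 5 + 0 by norm_num))
      congr 1
      · simp
      · exact thetaExp_add_eq (by push_cast; ring)
    all_goals
      refine hasSum_of_forall_eq (fun p => ?_) (hasSum_theta_mul_theta 1 1
        (show 1 ≤ 1 + 4 by norm_num) (show 1 ≤ 2 + 3 by norm_num))
      congr 1
      · simp
      · exact (thetaExp_add_eq (k := 0) (by push_cast; ring)).trans (add_zero _)

/-- `φ(-q)^2` is a signed sum over the Gaussian integers. Those divisible by `2 + i` give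
`φ(-q^5)^2`; multiplication by the units permutes the other four residue classes modulo `2 + i`,
each of which gives a product of two theta series. -/
theorem phiNeg_sq_eq_sub_theta_mul_theta :
    phiNeg 1 ^ 2 = phiNeg 5 ^ 2 - 4 * X * (theta (-1) 1 9 * theta (-1) 3 7) := by
  -- Map 0 is multiplication by `2 + i`, map 1 sends `(a, b)` to
  -- `(-(5 a - 2) + (5 b - 1) i) / (2 - i)`, and maps 2, 3, 4 are its rotations.
  have h := eq_sum_of_hasSum_of_partition
    (hasSum_theta_mul_theta (-1) (-1) (show 1 ≤ 1 + 1 by norm_num) (show 1 ≤ 1 + 1 by norm_num))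
    (r := 5) (fun i (p : ℤ × ℤ) => match i with
      | 0 => (2 * p.1 - p.2, p.1 + 2 * p.2)
      | 1 => (-2 * p.1 - p.2 + 1, -p.1 + 2 * p.2)
      | 2 => (p.1 - 2 * p.2, -2 * p.1 - p.2 + 1)
      | 3 => (2 * p.1 + p.2 - 1, p.1 - 2 * p.2)
      | 4 => (-p.1 + 2 * p.2, 2 * p.1 + p.2 - 1)) ?_ ?_
    (s := fun i => match i with
      | 0 => theta (-1) 5 5 * theta (-1) 5 5
      | 1 | 2 | 3 | 4 => -(X * (theta (-1) 1 9 * theta (-1) 3 7))) ?_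
  · simp only [Fin.sum_univ_five] at h
    unfold phiNeg
    linear_combination h
  · rintro ⟨i, a, b⟩ ⟨j, c, d⟩ h
    fin_cases i <;> fin_cases j <;> simp at h ⊢ <;> omega
  · rintro ⟨x, y⟩
    have hcases : (2 * x + y) % 5 = 0 ∨ (2 * x + y) % 5 = 2 ∨ (2 * x + y) % 5 = 1 ∨
      (2 * x + y) % 5 = 3 ∨ (2 * x + y) % 5 = 4 := by omega
    rcases hcases with hc | hc | hc | hc | hc
    · exact ⟨(0, (2 * x + y) / 5, (2 * y - x) / 5), by ext <;> dsimp only <;> omega⟩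
    · exact ⟨(1, (-2 * x - y + 2) / 5, (2 * y - x + 1) / 5), by ext <;> dsimp only <;> omega⟩
    · exact ⟨(2, (x - 2 * y + 2) / 5, (-2 * x - y + 1) / 5), by ext <;> dsimp only <;> omega⟩
    · exact ⟨(3, (2 * x + y + 2) / 5, (x - 2 * y + 1) / 5), by ext <;> dsimp only <;> omega⟩
    · exact ⟨(4, (2 * y - x + 2) / 5, (2 * x + y + 1) / 5), by ext <;> dsimp only <;> omega⟩
  · intro i
    fin_cases i
    · refine hasSum_of_forall_eq (fun p => ?_) (hasSum_theta_mul_theta (-1) (-1)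
        (show 1 ≤ 5 + 5 by norm_num) (show 1 ≤ 5 + 5 by norm_num))
      congr 1
      · simp only [← zpow_add]
        exact neg_one_zpow_eq (by rw [Int.even_iff]; omega)
      · exact (thetaExp_add_eq (k := 0) (by push_cast; ring)).trans (add_zero _)
    all_goals
      refine hasSum_of_forall_eq (fun p => ?_) (hasSum_X_mul_theta_mul_theta (-1) (-1)
        (show 1 ≤ 1 + 9 by norm_num) (show 1 ≤ 3 + 7 by norm_num)).neg
      rw [← signedMonomial_neg]
      congr 1
      · simp only [← zpow_add]
        exact neg_one_zpow_eq_neg (by rw [Int.odd_iff]; omega)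
      · exact thetaExp_add_eq (by push_cast; ring)

/-- The exponent `((2 u + 1 + v)^2 + 5 v^2 - 1) / 4`, a shifted norm from `ℤ[√-5]`. -/
def normExp (u v : ℤ) : ℤ := u ^ 2 + u * (v + 1) + v ^ 2 + tri v

theorem four_mul_normExp_add_one (u v : ℤ) :
    4 * normExp u v + 1 = (2 * u + 1 + v) ^ 2 + 5 * v ^ 2 := by
  have h := two_mul_tri v
  unfold normExp
  linear_combination 2 * h

theorem finite_normExp_le (d : ℕ) : {p : ℤ × ℤ | normExp p.1 p.2 ≤ d}.Finite := by
  refine ((Set.finite_Icc (-(6 * d + 6 : ℤ)) (6 * d + 6)).prod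
    (Set.finite_Icc (-(6 * d + 6 : ℤ)) (6 * d + 6))).subset fun p hp => ?_
  replace hp : normExp p.1 p.2 ≤ d := hp
  have h := four_mul_normExp_add_one p.1 p.2
  have hv : |p.2| ≤ 2 * d + 1 := by
    rw [abs_le]
    constructor <;> nlinarith [sq_nonneg (2 * p.1 + 1 + p.2), sq_nonneg (p.2 + 1),
      sq_nonneg (p.2 - 1)]
  have hb : |2 * p.1 + 1 + p.2| ≤ 4 * d + 1 := by
    rw [abs_le]
    constructor <;> nlinarith [sq_nonneg p.2, sq_nonneg (2 * p.1 + 1 + p.2 + 1),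
      sq_nonneg (2 * p.1 + 1 + p.2 - 1)]
  rw [abs_le] at hv hb
  exact ⟨⟨by linarith, by linarith⟩, ⟨by linarith, by linarith⟩⟩

theorem thetaExp_add_eq_normExp {a b c d : ℕ} {m n u v k : ℤ}
    (h : 2 * (a * (m * (m + 1)) + b * (m * (m - 1)) + (c * (n * (n + 1)) + d * (n * (n - 1)))) +
      4 * k + 1 = (2 * u + 1 + v) ^ 2 + 5 * v ^ 2) :
    normExp u v = thetaExp a b m + thetaExp c d n + k := by
  have h1 := two_mul_thetaExp a b m
  have h2 := two_mul_thetaExp c d n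
  have h3 := four_mul_normExp_add_one u v
  linarith

/-- The sum `∑ (-1)^v q^{((2 u + 1 + v)^2 + 5 v^2 - 1) / 4}`, over the elements `x + y √-5` of
`ℤ[√-5]` with `x + y` odd, written `x = 2 u + 1 + v` and `y = v`. -/
noncomputable def normSeries : ℤ⟦X⟧ :=
  ∑' p : ℤ × ℤ, signedMonomial ((-1) ^ p.2) (normExp p.1 p.2)

theorem hasSum_normSeries :
    HasSum (fun p : ℤ × ℤ => signedMonomial ((-1) ^ p.2) (normExp p.1 p.2)) normSeries :=
  (summable_signedMonomial (s := fun p : ℤ × ℤ => (-1) ^ p.2)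
    (E := fun p : ℤ × ℤ => normExp p.1 p.2) finite_normExp_le).hasSum

theorem normSeries_eq_phi_mul_psi_sub :
    normSeries = 2 * (phi 5 * psi 2 - X * phi 1 * psi 10) := by
  have h := eq_sum_of_hasSum_of_partition hasSum_normSeries
    (r := 2) (fun i (p : ℤ × ℤ) => match i with
      | 0 => (p.2 - p.1, 2 * p.1)
      | 1 => (p.1 - p.2 - 1, 2 * p.2 + 1)) ?_ ?_
    (s := fun i => match i with
      | 0 => theta 1 5 5 * theta 1 2 0
      | 1 => -(X * (theta 1 1 1 * theta 1 10 0))) ?_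
  · rw [h, Fin.sum_univ_two, ← two_mul_psi (by norm_num), ← two_mul_psi (by norm_num), phi, phi]
    ring
  · rintro ⟨i, a, b⟩ ⟨j, c, d⟩ h
    fin_cases i <;> fin_cases j <;> simp at h ⊢ <;> omega
  · rintro ⟨u, v⟩
    obtain ⟨n, rfl | rfl⟩ := Int.even_or_odd' v
    · exact ⟨(0, n, u + n), Prod.ext (by dsimp only; ring) rfl⟩
    · exact ⟨(1, u + n + 1, n), Prod.ext (by dsimp only; ring) rfl⟩
  · intro i
    fin_cases i
    · refine hasSum_of_forall_eq (fun p => ?_) (hasSum_theta_mul_theta 1 1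
        (show 1 ≤ 5 + 5 by norm_num) (show 1 ≤ 2 + 0 by norm_num))
      congr 1
      · simp [zpow_mul]
      · exact (thetaExp_add_eq_normExp (k := 0) (by push_cast; ring)).trans (add_zero _)
    · refine hasSum_of_forall_eq (fun p => ?_) (hasSum_X_mul_theta_mul_theta 1 1
        (show 1 ≤ 1 + 1 by norm_num) (show 1 ≤ 10 + 0 by norm_num)).neg
      rw [← signedMonomial_neg]
      congr 1
      · simp [zpow_mul, zpow_add]
      · exact thetaExp_add_eq_normExp (by push_cast; ring)

/-- Splitting by the residue of `x + y` modulo `3`: each nonzero class is the product of two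
pentagonal number series, and the zero class cancels under the norm-preserving map
`β ↦ β̄ (2 + √-5) / 3`, which changes the parity of `y`. -/
theorem normSeries_eq_f_mul_f : normSeries = 2 * (f 1 * f 5) := by
  have hinj : Function.Injective fun p : ℤ × ℤ => (3 * p.1 + 1 - p.2, p.2) := by
    rintro ⟨a, b⟩ ⟨c, d⟩ h
    simp at h ⊢
    omega
  obtain ⟨W, hW⟩ : Summable fun p : ℤ × ℤ =>
      signedMonomial ((-1) ^ p.2) (normExp (3 * p.1 + 1 - p.2) p.2) :=
    summable_signedMonomial (s := fun p : ℤ × ℤ => (-1) ^ p.2)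
      (E := fun p : ℤ × ℤ => normExp (3 * p.1 + 1 - p.2) p.2) fun d =>
      (finite_normExp_le d).preimage
        (f := fun p : ℤ × ℤ => (3 * p.1 + 1 - p.2, p.2)) hinj.injOn
  -- The map `(x + y √-5) ↦ (x - y √-5) (2 + √-5) / 3` in the coordinates of the zero class.
  have hW0 : W = 0 := by
    have hinv : Function.Involutive fun p : ℤ × ℤ => (p.1, 2 * p.1 + 1 - p.2) := fun p => by
      exact Prod.ext rfl (by dsimp only; ring)
    have h := ((hinv.toPerm _).hasSum_iff.mpr hW).unique (hasSum_of_forall_eq (fun p => ?_) hW.neg)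
    · have := charZero_powerSeries
      have h2 : (2 : ℤ⟦X⟧) * W = 0 := by linear_combination h
      simpa using h2
    · rw [Function.comp_apply, Function.Involutive.coe_toPerm, ← signedMonomial_neg]
      congr 1
      · exact neg_one_zpow_eq_neg (by rw [Int.odd_iff]; omega)
      · have h1 := four_mul_normExp_add_one (3 * p.1 + 1 - p.2) p.2
        have h2 := four_mul_normExp_add_one (3 * p.1 + 1 - (2 * p.1 + 1 - p.2)) (2 * p.1 + 1 - p.2)
        refine mul_left_cancel₀ (show (4 : ℤ) ≠ 0 by norm_num) ?_
        linear_combination h2 - h1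
  rw [hW0] at hW
  -- Map 1 sends `(m, n)` to `((6 m - 1) + (6 n - 1) √-5) / (1 + √-5)`, and map 2 is its negative.
  have h := eq_sum_of_hasSum_of_partition hasSum_normSeries
    (r := 3) (fun i (p : ℤ × ℤ) => match i with
      | 0 => (3 * p.1 + 1 - p.2, p.2)
      | 1 => (p.1 + 2 * p.2 - 1, p.2 - p.1)
      | 2 => (-p.1 - 2 * p.2, p.1 - p.2)) ?_ ?_
    (s := fun i => match i with
      | 0 => 0
      | 1 | 2 => theta (-1) 1 2 * theta (-1) 5 10) ?_
  · rw [h, Fin.sum_univ_three, f_eq_theta le_rfl, f_eq_theta (show 1 ≤ 5 by norm_num)]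
    ring
  · rintro ⟨i, a, b⟩ ⟨j, c, d⟩ h
    fin_cases i <;> fin_cases j <;> simp at h ⊢ <;> omega
  · rintro ⟨u, v⟩
    have hcases : (u + v) % 3 = 1 ∨ (u + v) % 3 = 2 ∨ (u + v) % 3 = 0 := by omega
    rcases hcases with hc | hc | hc
    · exact ⟨(0, (u + v - 1) / 3, v), Prod.ext (by dsimp only; omega) rfl⟩
    · exact ⟨(1, (u - 2 * v + 1) / 3, (u + v + 1) / 3), by ext <;> dsimp only <;> omega⟩
    · exact ⟨(2, (2 * v - u) / 3, -(u + v) / 3), by ext <;> dsimp only <;> omega⟩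
  · intro i
    fin_cases i
    · exact hW
    all_goals
      refine hasSum_of_forall_eq (fun p => ?_) (hasSum_theta_mul_theta (-1) (-1)
        (show 1 ≤ 1 + 2 by norm_num) (show 1 ≤ 5 + 10 by norm_num))
      congr 1
      · simp only [← zpow_add]
        exact neg_one_zpow_eq (by rw [Int.even_iff]; omega)
      · exact (thetaExp_add_eq_normExp (k := 0) (by push_cast; ring)).trans (add_zero _)

theorem phi_mul_psi_sub_phi_mul_psi : phi 5 * psi 2 - X * phi 1 * psi 10 = f 1 * f 5 := by
  have := charZero_powerSeries
  refine mul_left_cancel₀ (show (2 : ℤ⟦X⟧) ≠ 0 by norm_num) ?_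
  rw [← normSeries_eq_phi_mul_psi_sub, normSeries_eq_f_mul_f]

/-! ### Two-dissections -/

/-- The coefficients of even index of `q S(q)` come from the odd part of `S`. -/
theorem coeff_two_mul_X_mul {S A B T : ℤ⟦X⟧} (hS : S = dilate A + X * dilate B) (hB : B = T)
    (n : ℕ) : coeff (2 * n) (X * S) = coeff n (X * T) := by
  have h : X * S = X * dilate A + dilate (X * B) := by
    rw [hS, map_mul, dilate_X]
    ring
  rw [h, map_add, coeff_dilate_two_mul, hB, add_eq_right]
  rcases n with _ | n
  · simp
  · rw [show 2 * (n + 1) = 2 * n + 1 + 1 by ring, coeff_succ_X_mul, coeff_dilate_two_mul_add_one]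

theorem phi_eq {m : ℕ} (hm : 1 ≤ m) : phi m = phi (4 * m) + 2 * X ^ m * psi (8 * m) := by
  have h := theta_eq_phi_add_psi 1 hm
  simp only [Units.val_one, map_one, mul_one] at h
  exact h

theorem phiNeg_eq {m : ℕ} (hm : 1 ≤ m) : phiNeg m = phi (4 * m) - 2 * X ^ m * psi (8 * m) := by
  have h := theta_eq_phi_add_psi (-1) hm
  simp only [Units.val_neg, Units.val_one, map_neg, map_one] at h
  unfold phiNeg
  linear_combination h

/-- Obtained by replacing `q` by `q^2` in the difference of squares `φ(q) φ(-q)`. -/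
theorem phiNeg_sq {m : ℕ} (hm : 1 ≤ m) :
    phiNeg m ^ 2 = phi (2 * m) ^ 2 - 4 * X ^ m * psi (4 * m) ^ 2 := by
  apply dilate_injective
  have h := phi_mul_phiNeg hm
  rw [phi_eq hm, phiNeg_eq hm] at h
  simp only [map_sub, map_mul, map_pow, dilate_X, map_ofNat, dilate_phiNeg hm,
    dilate_phi (show 1 ≤ 2 * m by omega), dilate_psi (show 1 ≤ 4 * m by omega), ← mul_assoc]
  norm_num
  linear_combination -h

/-- The identity for `f_1 f_5` with `q` replaced by `q^2`. -/
theorem phi_ten_mul_psi_four : phi 10 * psi 4 - X ^ 2 * phi 2 * psi 20 = f 2 * f 10 := by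
  have h := congrArg dilate phi_mul_psi_sub_phi_mul_psi
  simpa [dilate_X, dilate_phi, dilate_psi, dilate_f] using h

/-- The common even part of `φ(q) φ(-q^5)` and `φ(-q) φ(q^5)`, with `q^2` replaced by `q`. -/
noncomputable def phiPhiEven : ℤ⟦X⟧ := phi 2 * phi 10 - 4 * X ^ 3 * psi 4 * psi 20

theorem phi_mul_phiNeg_five :
    phi 1 * phiNeg 5 = dilate phiPhiEven + X * dilate (2 * (f 2 * f 10)) := by
  rw [← phi_ten_mul_psi_four, phi_eq le_rfl, phiNeg_eq (show 1 ≤ 5 by norm_num)]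
  simp [phiPhiEven, dilate_X, dilate_phi, dilate_psi]
  simp only [map_ofNat]
  ring

theorem phiNeg_mul_phi_five :
    phiNeg 1 * phi 5 = dilate phiPhiEven - X * dilate (2 * (f 2 * f 10)) := by
  rw [← phi_ten_mul_psi_four, phiNeg_eq le_rfl, phi_eq (show 1 ≤ 5 by norm_num)]
  simp [phiPhiEven, dilate_X, dilate_phi, dilate_psi]
  simp only [map_ofNat]
  ring

/-! ### The action of `U` on the generating functions -/

/-- `f_1^4 f_5^4`; times `q` it is a cusp form of level 5 and weight 4. -/
noncomputable def formH : ℤ⟦X⟧ := f 1 ^ 4 * f 5 ^ 4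

/-- `f_1^3 f_2^3 f_5 f_10`, the first of three series whose span is preserved by `U` after
multiplication by `q`. -/
noncomputable def formK : ℤ⟦X⟧ := f 1 ^ 3 * f 2 ^ 3 * f 5 * f 10

/-- `f_1^2 f_5^2 ψ(q)^4`, the second of the three series. -/
noncomputable def formL : ℤ⟦X⟧ := f 1 ^ 2 * f 5 ^ 2 * psi 1 ^ 4

/-- `f_2^2 f_10^2 φ(-q)^4`, the third of the three series. -/
noncomputable def formN : ℤ⟦X⟧ := f 2 ^ 2 * f 10 ^ 2 * phiNeg 1 ^ 4

theorem coeff_two_mul_formN (n : ℕ) :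
    coeff (2 * n) (X * formN) = -8 * coeff n (X * formL) := by
  have h : coeff (2 * n) (X * formN) = coeff n (X * (-8 * formL)) := by
    refine coeff_two_mul_X_mul (A := f 1 ^ 2 * f 5 ^ 2 * (phi 1 ^ 4 + 16 * X * psi 2 ^ 4))
      (B := f 1 ^ 2 * f 5 ^ 2 * (-8 * (phi 1 * psi 2) ^ 2)) ?_ ?_ n
    · rw [formN, show phiNeg 1 ^ 4 = (phiNeg 1 ^ 2) ^ 2 by ring, phiNeg_sq le_rfl]
      simp [dilate_X, dilate_phi, dilate_psi, dilate_f]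
      simp only [map_ofNat]
      ring
    · rw [phi_mul_psi le_rfl, formL]
      ring
  rw [h, show X * (-8 * formL) = C (-8) * (X * formL) by simp; ring, coeff_C_mul]

theorem coeff_two_mul_formL (n : ℕ) : coeff (2 * n) (X * formL) = 2 * coeff n (X * formK) := by
  have h : coeff (2 * n) (X * formL) = coeff n (X * (2 * formK)) := by
    refine coeff_two_mul_X_mul (A := f 1 * f 5 * (phiNeg 1 * psi 1) ^ 2 * phiPhiEven)
      (B := f 1 * f 5 * (phiNeg 1 * psi 1) ^ 2 * (2 * (f 2 * f 10))) ?_ ?_ n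
    · have h1 := phiNeg_mul_f (show 1 ≤ 1 by norm_num)
      have h2 := phiNeg_mul_f (show 1 ≤ 5 by norm_num)
      have h3 : phi 1 * psi 2 = psi 1 ^ 2 := phi_mul_psi le_rfl
      have h4 : phi 1 * phiNeg 1 = phiNeg 2 ^ 2 := phi_mul_phiNeg le_rfl
      norm_num at h1 h2
      calc formL = f 2 * f 10 * psi 2 ^ 2 * (phi 1 * phiNeg 1) * (phi 1 * phiNeg 5) := by
            rw [formL, ← h1, ← h2, show psi 1 ^ 4 = (psi 1 ^ 2) ^ 2 by ring, ← h3]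
            ring
        _ = _ := by
            rw [h4, phi_mul_phiNeg_five]
            simp [dilate_phiNeg, dilate_psi, dilate_f]
            ring
    · rw [phiNeg_mul_psi le_rfl, formK]
      ring
  rw [h, show X * (2 * formK) = C 2 * (X * formK) by simp; ring, coeff_C_mul]

theorem coeff_two_mul_formK (n : ℕ) :
    coeff (2 * n) (X * formK) = -2 * coeff n (X * formK) - coeff n (X * formN) := by
  have h : coeff (2 * n) (X * formK) = coeff n (X * (-2 * formK - formN)) := by
    have h1 : phiNeg 1 * f 2 = f 1 ^ 2 := phiNeg_mul_f le_rfl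
    have h2 : psi 1 * f 1 = f 2 ^ 2 := psi_mul_f le_rfl
    have h3 : phi 1 * phiNeg 1 = phiNeg 2 ^ 2 := phi_mul_phiNeg le_rfl
    have h4 : psi 5 * f 5 = f 10 ^ 2 := psi_mul_f (by norm_num)
    refine coeff_two_mul_X_mul (A := f 1 ^ 4 * f 5 * (psi 1 * phiPhiEven))
      (B := f 1 ^ 4 * f 5 * (-2 * (psi 1 * (f 2 * f 10)) - phiNeg 1 ^ 2 * psi 5)) ?_ ?_ n
    · calc formK = f 2 ^ 4 * f 10 * (psi 2 * (phiNeg 1 * phi 5) -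
            X * (phi 1 * phiNeg 1) * psi 10) := by
            rw [formK]
            linear_combination (-f 1 * f 5 * f 2 ^ 3 * f 10) * h1 -
              f 2 ^ 4 * f 10 * phiNeg 1 * phi_mul_psi_sub_phi_mul_psi
        _ = _ := by
            rw [h3, phiNeg_mul_phi_five]
            simp [dilate_phiNeg, dilate_psi, dilate_f]
            ring
    · rw [formK, formN]
      linear_combination (-2 * f 1 ^ 3 * f 5 * f 2 * f 10) * h2 -
        f 1 ^ 4 * phiNeg 1 ^ 2 * h4 +
        f 10 ^ 2 * phiNeg 1 ^ 2 * (f 1 ^ 2 + phiNeg 1 * f 2) * h1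
  rw [h, show X * (-2 * formK - formN) = C (-2) * (X * formK) - X * formN by simp; ring, map_sub,
    coeff_C_mul]

/-- The operator `U` on `H`: the Hecke relation `T_2 H = -4 H` at weight 4. -/
theorem coeff_two_mul_formH (n : ℕ) :
    coeff (2 * n) (X * formH) = -4 * coeff n (X * formH) - 8 * coeff n (dilate (X * formH)) := by
  have h : coeff (2 * n) (X * formH) = coeff n (X * (-4 * formH - 8 * X * dilate formH)) := by
    have h1 : phiNeg 1 * f 2 = f 1 ^ 2 := phiNeg_mul_f le_rfl
    have h2 : phiNeg 5 * f 10 = f 5 ^ 2 := phiNeg_mul_f (by norm_num)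
    have h3 : phi 1 * psi 2 = psi 1 ^ 2 := phi_mul_psi le_rfl
    have h4 : phi 5 * psi 10 = psi 5 ^ 2 := phi_mul_psi (by norm_num)
    have h5 : psi 1 * f 1 = f 2 ^ 2 := psi_mul_f le_rfl
    have h6 : psi 5 * f 5 = f 10 ^ 2 := psi_mul_f (by norm_num)
    refine coeff_two_mul_X_mul
      (A := f 1 ^ 2 * f 5 ^ 2 * (phi 1 ^ 2 * phi 5 ^ 2 + 16 * X ^ 3 * psi 2 ^ 2 * psi 10 ^ 2))
      (B := f 1 ^ 2 * f 5 ^ 2 * (-4 * (phi 5 * psi 2 - X * phi 1 * psi 10) ^ 2 -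
        8 * X * (phi 1 * psi 2) * (phi 5 * psi 10))) ?_ ?_ n
    · calc formH = (phiNeg 1 * f 2) ^ 2 * (phiNeg 5 * f 10) ^ 2 := by rw [h1, h2, formH]; ring
        _ = f 2 ^ 2 * f 10 ^ 2 * (phiNeg 1 ^ 2 * phiNeg 5 ^ 2) := by ring
        _ = _ := by
          rw [phiNeg_sq le_rfl, phiNeg_sq (show 1 ≤ 5 by norm_num)]
          simp [dilate_X, dilate_phi, dilate_psi, dilate_f]
          simp only [map_ofNat]
          ring
    · rw [phi_mul_psi_sub_phi_mul_psi, h3, h4]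
      have h7 : dilate formH = (psi 1 * f 1) ^ 2 * (psi 5 * f 5) ^ 2 := by
        rw [h5, h6]
        simp [formH, dilate_f]
        ring
      rw [h7, formH]
      ring
  rw [h, show X * (-4 * formH - 8 * X * dilate formH) =
    C (-4) * (X * formH) - C 8 * dilate (X * formH) by simp [dilate_X]; ring, map_sub,
    coeff_C_mul, coeff_C_mul]

theorem coeff_two_mul_M (n : ℕ) :
    coeff (2 * n) (X * PowerSeries.mk M) = 2 * coeff n (X * formK) - coeff n (X * formH) := by
  have h : coeff (2 * n) (X * PowerSeries.mk M) = coeff n (X * (2 * formK - formH)) := by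
    have h1 : psi 1 * f 1 = f 2 ^ 2 := psi_mul_f le_rfl
    have h2 : phiNeg 5 * f 10 = f 5 ^ 2 := phiNeg_mul_f (by norm_num)
    have h3 : phi 1 * psi 2 = psi 1 ^ 2 := phi_mul_psi le_rfl
    have h4 : phi 5 * psi 10 = psi 5 ^ 2 := phi_mul_psi (by norm_num)
    have h5 : phi 5 * phiNeg 5 = phiNeg 10 ^ 2 := phi_mul_phiNeg (by norm_num)
    have h6 : psi 5 * f 5 = f 10 ^ 2 := psi_mul_f (by norm_num)
    have h7 := psi_sq_eq_add_theta_mul_theta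
    have h8 := theta_one_four_mul_theta_two_three
    refine coeff_two_mul_X_mul (A := f 1 ^ 4 * f 5 * (psi 1 * phiPhiEven))
      (B := f 1 ^ 4 * f 5 * (2 * (psi 1 * (f 2 * f 10)) - phiNeg 5 ^ 2 * psi 5)) ?_ ?_ n
    · have hM : PowerSeries.mk M = f 2 ^ 4 * f 5 ^ 2 * (psi 1 ^ 2 - X * psi 5 ^ 2) := by
        refine mul_right_cancel₀ (mul_ne_zero (f_ne_zero (show 1 ≤ 1 by norm_num))
          (f_ne_zero (show 1 ≤ 10 by norm_num))) ?_
        rw [mk_M_mul]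
        linear_combination -f 2 ^ 4 * f 5 ^ 2 * h8 - f 2 ^ 4 * f 5 ^ 2 * f 1 * f 10 * h7
      calc PowerSeries.mk M = f 2 ^ 4 * f 10 * (psi 2 * (phi 1 * phiNeg 5) -
            X * (phi 5 * phiNeg 5) * psi 10) := by
            rw [hM, ← h2, ← h3, ← h4]
            ring
        _ = _ := by
            rw [h5, phi_mul_phiNeg_five]
            simp [dilate_phiNeg, dilate_psi, dilate_f]
            ring
    · rw [formK, formH]
      linear_combination (2 * f 1 ^ 3 * f 5 * f 2 * f 10) * h1 - f 1 ^ 4 * phiNeg 5 ^ 2 * h6 -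
        f 1 ^ 4 * (f 5 ^ 2 + phiNeg 5 * f 10) * h2
  rw [h, show X * (2 * formK - formH) = C 2 * (X * formK) - X * formH by simp; ring, map_sub,
    coeff_C_mul]

/-- The generating function of `T*` lies in the span of the series already treated, up to a factor 4.
That factor is recovered from the extra powers of two in `H` and `N`. -/
theorem four_mul_coeff_Tstar (n : ℕ) :
    4 * coeff n (X * (X * PowerSeries.mk Tstar)) = coeff n (X * formH) - coeff n (X * formN) := by
  have h1 : phiNeg 1 * f 2 = f 1 ^ 2 := phiNeg_mul_f le_rfl
  have h2 : phiNeg 5 * f 10 = f 5 ^ 2 := phiNeg_mul_f (by norm_num)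
  have h3 := phiNeg_sq_eq_sub_theta_mul_theta
  have h4 := theta_one_nine_mul_theta_three_seven
  have h : C 4 * (X * (X * PowerSeries.mk Tstar)) = X * formH - X * formN := by
    refine mul_right_cancel₀ (mul_ne_zero (f_ne_zero (show 1 ≤ 2 by norm_num))
      (f_ne_zero (show 1 ≤ 5 by norm_num))) ?_
    have h5 : formH - formN = 4 * X * f 1 ^ 4 * f 10 ^ 2 *
        (theta (-1) 1 9 * theta (-1) 3 7) := by
      have h6 : formH - formN = (f 2 * phiNeg 1) ^ 2 * f 10 ^ 2 * (phiNeg 5 ^ 2 - phiNeg 1 ^ 2) := by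
        rw [formH, formN, show f 1 ^ 4 * f 5 ^ 4 = (f 1 ^ 2) ^ 2 * (f 5 ^ 2) ^ 2 by ring, ← h1,
          ← h2]
        ring
      rw [h6, mul_comm (f 2), h1, h3]
      ring
    have hC : (C 4 : ℤ⟦X⟧) = 4 := by simp
    rw [hC]
    linear_combination 4 * X ^ 2 * mk_Tstar_mul - X * f 2 * f 5 * h5 -
      4 * X ^ 2 * f 1 ^ 4 * f 10 ^ 2 * h4
  rw [← map_sub, ← h, coeff_C_mul]

/-! ### Divisibility by powers of two -/

theorem two_pow_dvd_coeff_formH (k m : ℕ) :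
    (2 : ℤ) ^ k ∣ coeff (2 ^ k * m) (X * formH) ∧
      (2 : ℤ) ^ (k + 2) ∣ coeff (2 ^ (k + 1) * m) (X * formH) := by
  induction k with
  | zero =>
    refine ⟨by simp, ?_⟩
    rw [show 2 ^ (0 + 1) * m = 2 * m by ring, coeff_two_mul_formH]
    exact ⟨-coeff m (X * formH) - 2 * coeff m (dilate (X * formH)), by ring⟩
  | succ k ih =>
    obtain ⟨⟨x, hx⟩, y, hy⟩ := ih
    refine ⟨⟨2 * y, by rw [hy]; ring⟩, -2 * y - x, ?_⟩
    rw [show 2 ^ (k + 1 + 1) * m = 2 * (2 ^ (k + 1) * m) by ring, coeff_two_mul_formH,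
      show 2 ^ (k + 1) * m = 2 * (2 ^ k * m) by ring, coeff_dilate_two_mul,
      show 2 * (2 ^ k * m) = 2 ^ (k + 1) * m by ring, hx, hy]
    ring

/-- The factors 2 absorb the loss of one power of two at the first application of `U`. -/
theorem two_pow_dvd_coeff_formK_formL_formN (k m : ℕ) :
    (2 : ℤ) ^ k ∣ 2 * coeff (2 ^ k * m) (X * formK) ∧
      (2 : ℤ) ^ k ∣ 2 * coeff (2 ^ k * m) (X * formL) ∧
      (2 : ℤ) ^ k ∣ coeff (2 ^ k * m) (X * formN) := by
  induction k with
  | zero => simp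
  | succ k ih =>
    obtain ⟨⟨x, hx⟩, ⟨y, hy⟩, z, hz⟩ := ih
    rw [show 2 ^ (k + 1) * m = 2 * (2 ^ k * m) by ring, coeff_two_mul_formK, coeff_two_mul_formL,
      coeff_two_mul_formN]
    refine ⟨⟨-x - z, ?_⟩, ⟨x, ?_⟩, -2 * y, ?_⟩
    · linear_combination -2 * hx - 2 * hz
    · linear_combination 2 * hx
    · linear_combination -4 * hy

theorem two_pow_dvd_coeff_M (k m : ℕ) :
    (2 : ℤ) ^ k ∣ coeff (2 ^ (k + 1) * m) (X * PowerSeries.mk M) := by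
  rw [show 2 ^ (k + 1) * m = 2 * (2 ^ k * m) by ring, coeff_two_mul_M]
  exact (two_pow_dvd_coeff_formK_formL_formN k m).1.sub (two_pow_dvd_coeff_formH k m).1

theorem two_pow_dvd_coeff_Tstar (k m : ℕ) :
    (2 : ℤ) ^ k ∣ coeff (2 ^ (k + 1) * m) (X * (X * PowerSeries.mk Tstar)) := by
  obtain ⟨x, hx⟩ := (two_pow_dvd_coeff_formH k m).2
  obtain ⟨y, hy⟩ := (two_pow_dvd_coeff_formK_formL_formN k m).2.1
  have h := four_mul_coeff_Tstar (2 ^ (k + 1) * m)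
  have hN := coeff_two_mul_formN (2 ^ k * m)
  rw [show 2 * (2 ^ k * m) = 2 ^ (k + 1) * m by ring] at hN
  refine ⟨x + y, mul_left_cancel₀ (show (4 : ℤ) ≠ 0 by norm_num) ?_⟩
  linear_combination h + hx - hN + 4 * hy

end PushpaVasuki

theorem theorem1p1 (k : ℕ) (n : ℤ) (hk : 1 ≤ k) (hn : -1 ≤ n) :
    PushpaVasuki.M ((2 : ℤ) ^ k * n + 2 ^ (k + 1) - 1).toNat ≡ 0 [ZMOD 2 ^ (k - 1)] ∧
    PushpaVasuki.Tstar ((2 : ℤ) ^ k * n + 2 ^ (k + 1) - 2).toNat ≡ 0 [ZMOD 2 ^ (k - 1)] := by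
  obtain ⟨h1, h2⟩ := PushpaVasuki.argument_nonneg hk hn
  obtain ⟨j, rfl⟩ := Nat.exists_eq_add_of_le' hk
  obtain ⟨m, hm⟩ := Int.eq_ofNat_of_zero_le (show 0 ≤ n + 2 by linarith)
  have hcast : ((2 ^ (j + 1) * m : ℕ) : ℤ) = 2 ^ (j + 1) * n + 2 ^ (j + 1 + 1) := by
    push_cast
    rw [← hm]
    ring
  rw [Nat.add_sub_cancel, Int.modEq_zero_iff_dvd, Int.modEq_zero_iff_dvd]
  have hM := PushpaVasuki.two_pow_dvd_coeff_M j m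
  have hT := PushpaVasuki.two_pow_dvd_coeff_Tstar j m
  constructor
  · rwa [show 2 ^ (j + 1) * m = ((2 : ℤ) ^ (j + 1) * n + 2 ^ (j + 1 + 1) - 1).toNat + 1 by omega,
      PowerSeries.coeff_succ_X_mul, PowerSeries.coeff_mk] at hM
  · rwa [show 2 ^ (j + 1) * m = ((2 : ℤ) ^ (j + 1) * n + 2 ^ (j + 1 + 1) - 2).toNat + 1 + 1 by
      omega, PowerSeries.coeff_succ_X_mul, PowerSeries.coeff_succ_X_mul, PowerSeries.coeff_mk] at hT
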